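/- All Banach spaces are real. Let $(E,\|\cdot\|)$ be a normed space. A set $F\subset E$ is an existence set in $E$ if for every $x\in E$ there is $d\in F$ with $\|d-c\|\le\|x-c\|$ for all $c\in F$. Given a norm $N$ on $E$, a set $A\subset E$ is contractive with respect to $N$ if there is a (not necessarily linear) map $P:E\to A$ with $P|_A=\mathrm{id}_A$ and $N(Px-Py)\le N(x-y)$ for all $x,y\in E$; contractive in $E$ means contractive with respect to $\|\cdot\|$. A half-space of $E$ is a set $\{x\in E: f(x)\le d\}$ with $f\in E^*$, $\|f\|=1$, $d\in\mathbb R$. A norm $N$ on $E$ is strictly convex if every point of its unit sphere is an extreme point of the sphere. Countable families below may be finite or empty, the empty intersection being the whole space. Theorem 3.1. Let $(X,\|\cdot\|)$ be a Banach space and let $F\subset X$ be a convex bounded existence set in $X$. Put $Z=\overline{\operatorname{span}}(F)$ and assume: 1. $(Z,\|\cdot\|)$ is reflexive and separable, and $F$ has nonempty interior relative to $Z$. 2. There are strictly convex norms $\|\cdot\|_n$ on $Z$ $(n\in\mathbb N)$ and numbers $s_n\ge 0$ with $s_n\to0$ such that $$(1-s_n)\|z\|_n\le\|z\|\le(1+s_n)\|z\|_n\qquad(z\in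 Z,\ n\in\mathbb N).$$ 3. If $F$ is the intersection of a countable family of half-spaces of $Z$ that are contractive in $(Z,\|\cdot\|)$, then $F$ is also the intersection of a countable family of convex subsets of $Z$, each of which is contractive with respect to $\|\cdot\|_n$ for every $n\in\mathbb N$. (Condition 3 holds in particular if $F$ is such an intersection of convex sets contractive with respect to every $\|\cdot\|_n$, or if every half-space of $Z$ that is contractive in $(Z,\|\cdot\|)$ is contractive with respect to every $\|\cdot\|_n$.) If $Z$ is a contractive subset of $X$, then $F$ is a contractive subset of $X$. -/

import Mathlib

open Set Filter Topology

section BestCoapproximation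

variable {E : Type*} [NormedAddCommGroup E] [NormedSpace ℝ E]

/-- The set `R_F(x)` of best coapproximants to `x` in `F`. -/
def coapprox (F : Set E) (x : E) : Set E :=
  {d | d ∈ F ∧ ∀ c ∈ F, ‖d - c‖ ≤ ‖x - c‖}

/-- `F` is an existence set of best coapproximation. (Such a set is automatically nonempty
and closed.) -/
def IsExistenceSet (F : Set E) : Prop :=
  ∀ x : E, (coapprox F x).Nonempty

/-- `A` is a contractive subset with respect to `N`: there is a projection `P` of the whole space
onto `A` (not necessarily linear) that is nonexpansive with respect to `N`. -/
def IsContractiveFor (N : Seminorm ℝ E) (A : Set E) : Prop :=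
  ∃ P : E → E, (∀ x, P x ∈ A) ∧ (∀ x ∈ A, P x = x) ∧ ∀ x y, N (P x - P y) ≤ N (x - y)

/-- `A` is a contractive subset of `E` with respect to the given norm of `E`. -/
def IsContractive (A : Set E) : Prop :=
  IsContractiveFor (normSeminorm ℝ E) A

/-- `N` is a norm, and it is strictly convex: every point of its unit sphere is an extreme point. -/
def IsStrictlyConvexNorm (N : Seminorm ℝ E) : Prop :=
  (∀ x, N x = 0 → x = 0) ∧ extremePoints ℝ {x | N x = 1} = {x | N x = 1}

/-- Half-spaces determined by a functional of norm one. -/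
def IsHalfSpace (H : Set E) : Prop :=
  ∃ (f : StrongDual ℝ E) (d : ℝ), ‖f‖ = 1 ∧ H = {x | f x ≤ d}

/-- `F` is the intersection of a countable family of contractive half-spaces. The empty family is
allowed; this only matters when `F` is the whole space. -/
def IsCountableInterContractiveHalfSpaces (F : Set E) : Prop :=
  ∃ 𝓗 : Set (Set E), 𝓗.Countable ∧ (∀ H ∈ 𝓗, IsHalfSpace H ∧ IsContractive H) ∧ F = ⋂₀ 𝓗

/-- `F` is the intersection of a countable family of convex sets, each of which is
contractive with respect to every norm `N n`. -/
def IsCountableInterContractiveFor (N : ℕ → Seminorm ℝ E) (F : Set E) : Prop :=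
  ∃ 𝓐 : Set (Set E), 𝓐.Countable ∧
    (∀ A ∈ 𝓐, Convex ℝ A ∧ ∀ n, IsContractiveFor (N n) A) ∧ F = ⋂₀ 𝓐

variable (E) in
/-- Reflexivity: the canonical embedding into the bidual is onto. -/
def IsReflexiveSpace : Prop :=
  Function.Surjective (NormedSpace.inclusionInDoubleDual ℝ E)

/-- The closed linear span `Z` of `F`. -/
abbrev closedSpan (F : Set E) : Submodule ℝ E :=
  (Submodule.span ℝ F).topologicalClosure

/-- `F` as a subset of its closed linear span. -/
def inClosedSpan (F : Set E) : Set (closedSpan F) :=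
  {z | (z : E) ∈ F}

end BestCoapproximation

/-! Everything takes place inside `Z`, the closed span of `F`; composing with a nonexpansive
retraction of `X` onto `Z` then gives the result. The core claim is that in `Z` the set `F` is a
countable intersection of contractive half-spaces. Smooth support points carry this claim. At such a
point of `F`, blowing up best coapproximation turns the supporting half-space into an existence set
(`isExistenceSet_setOf_le`), and an existence half-space is contractive (`isContractive_setOf_le`).
Separability supplies enough smooth points: sliding a small compact body, smooth at its own support
points, from inside `F` towards an outside point makes it touch the boundary at a smooth point of
`F` (`exists_smooth_support_lt`). The family hypothesis then writes `F` as an intersection of sets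
contractive for every `N n`. Strict convexity makes this intersection contractive for `N n`, via a
minimal nonexpansive map fixing `F` (`isContractiveFor_sInter`). A weak limit of these retractions
as `n → ∞` is nonexpansive for the original norm (`isContractive_of_tendsto`). -/

/-! ### Weak limits along filters, and weak compactness in reflexive spaces. -/

section WeakLimits

variable {E : Type*} [NormedAddCommGroup E] [NormedSpace ℝ E]

/-- `z` is the weak limit of `u` along `l`. -/
def WeakLim {ι : Type*} (l : Filter ι) (u : ι → E) (z : E) : Prop :=
  ∀ f : StrongDual ℝ E, Tendsto (fun i => f (u i)) l (𝓝 (f z))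

theorem WeakLim.const {ι : Type*} (l : Filter ι) (z : E) : WeakLim l (fun _ => z) z :=
  fun _ => tendsto_const_nhds

theorem WeakLim.sub {ι : Type*} {l : Filter ι} {u v : ι → E} {y z : E}
    (hu : WeakLim l u y) (hv : WeakLim l v z) : WeakLim l (fun i => u i - v i) (y - z) := by
  intro f
  simpa using (hu f).sub (hv f)

/-- Mazur's theorem: by Hahn–Banach, closed convex sets are weakly closed. Weak lower semicontinuity
of continuous seminorms follows by applying this to their sublevel sets. -/
theorem WeakLim.mem {ι : Type*} {l : Filter ι} [l.NeBot] {u : ι → E} {z : E}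
    (hu : WeakLim l u z) {C : Set E} (hC : Convex ℝ C) (hC' : IsClosed C)
    (h : ∀ᶠ i in l, u i ∈ C) : z ∈ C := by
  by_contra hz
  obtain ⟨f, a, hf, ha⟩ := geometric_hahn_banach_closed_point hC hC' hz
  exact absurd (le_of_tendsto (hu f) (h.mono fun i hi => (hf _ hi).le)) (not_le.2 ha)

theorem WeakLim.eq_of_const {ι : Type*} {l : Filter ι} [l.NeBot] {u : ι → E} {y z : E}
    (hu : WeakLim l u z) (h : ∀ᶠ i in l, u i = y) : z = y :=
  hu.mem (C := {y}) (convex_singleton y) isClosed_singleton h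

theorem Seminorm.convex_setOf_le (N : Seminorm ℝ E) (a : ℝ) : Convex ℝ {z | N z ≤ a} := by
  simpa using N.convexOn.convex_le a

theorem WeakLim.seminorm_le {ι : Type*} {l : Filter ι} [l.NeBot] {u : ι → E} {z : E}
    (hu : WeakLim l u z) {N : Seminorm ℝ E} (hN : Continuous N) {a : ℝ}
    (h : ∀ᶠ i in l, N (u i) ≤ a) : N z ≤ a :=
  hu.mem (N.convex_setOf_le a) (isClosed_le hN continuous_const) h

theorem continuous_normSeminorm : Continuous (normSeminorm ℝ E) := continuous_norm

theorem WeakLim.norm_le {ι : Type*} {l : Filter ι} [l.NeBot] {u : ι → E} {z : E}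
    (hu : WeakLim l u z) {a : ℝ} (h : ∀ᶠ i in l, ‖u i‖ ≤ a) : ‖z‖ ≤ a :=
  hu.seminorm_le (N := normSeminorm ℝ E) continuous_normSeminorm h

theorem WeakLim.norm_le_of_tendsto {ι : Type*} {l : Filter ι} [l.NeBot] {u : ι → E} {z : E}
    (hu : WeakLim l u z) {a : ι → ℝ} {b : ℝ} (ha : Tendsto a l (𝓝 b))
    (h : ∀ᶠ i in l, ‖u i‖ ≤ a i) : ‖z‖ ≤ b := by
  refine le_of_forall_pos_le_add fun ε hε => hu.norm_le ?_
  filter_upwards [h, ha.eventually_lt_const (lt_add_of_pos_right b hε)] with i h₁ h₂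
  exact h₁.trans h₂.le

/-- In a reflexive space, bounded families have weak limits along ultrafilters. -/
theorem IsReflexiveSpace.exists_weakLim (hE : IsReflexiveSpace E) {ι : Type*} (l : Ultrafilter ι)
    {u : ι → E} {C : ℝ} (hu : ∀ᶠ i in (l : Filter ι), ‖u i‖ ≤ C) :
    ∃ z, WeakLim (l : Filter ι) u z := by
  let J : E → WeakDual ℝ (StrongDual ℝ E) := fun x =>
    StrongDual.toWeakDual (NormedSpace.inclusionInDoubleDual ℝ E x)
  -- Banach–Alaoglu in the bidual gives a weak-* limit, which reflexivity brings back to `E`.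
  have hK := WeakDual.isCompact_closedBall (𝕜 := ℝ) (0 : StrongDual ℝ (StrongDual ℝ E)) C
  obtain ⟨φ, -, hφ⟩ := hK.ultrafilter_le_nhds (l.map (fun i => J (u i))) (by
    rw [le_principal_iff]
    change ∀ᶠ i in (l : Filter ι), _
    filter_upwards [hu] with i hi
    simp only [mem_preimage, mem_closedBall_zero_iff]
    exact (NormedSpace.double_dual_bound ℝ E (u i)).trans hi)
  obtain ⟨z, hz⟩ := hE (WeakDual.toStrongDual φ)
  refine ⟨z, fun f => ?_⟩
  have h1 : Tendsto (fun i => J (u i)) (l : Filter ι) (𝓝 φ) := hφ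
  have h2 := ((WeakDual.eval_continuous f).tendsto φ).comp h1
  have h3 : φ f = f z := by
    have := congrArg (fun ψ : StrongDual ℝ (StrongDual ℝ E) => ψ f) hz
    simpa using this.symm
  rw [← h3]
  exact h2

end WeakLimits

/-! ### Intersections of contractive sets, and approximation of the norm. -/

section StrictlyConvex

variable {E : Type*} [NormedAddCommGroup E] [NormedSpace ℝ E]

theorem IsStrictlyConvexNorm.eq_of_midpoint {N : Seminorm ℝ E} (hN : IsStrictlyConvexNorm N)
    {u v : E} (huv : N u = N v) (hm : N ((1 / 2 : ℝ) • (u + v)) = N u) : u = v := by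
  rcases (apply_nonneg N u).eq_or_lt' with h0 | h0
  · rw [hN.1 u h0, hN.1 v (huv ▸ h0)]
  have hsc : ∀ w, N w = N u → N ((N u)⁻¹ • w) = 1 := fun w hw => by
    rw [map_smul_eq_mul, hw, Real.norm_of_nonneg (inv_nonneg.2 h0.le), inv_mul_cancel₀ h0.ne']
  have hx : (N u)⁻¹ • ((1 / 2 : ℝ) • (u + v)) ∈ extremePoints ℝ {x | N x = 1} := by
    rw [hN.2]; exact hsc _ hm
  have := (mem_extremePoints.1 hx).2 _ (hsc u rfl) _ (hsc v huv.symm)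
    ⟨1 / 2, 1 / 2, by norm_num, by norm_num, by norm_num, by module⟩
  exact smul_right_injective E (inv_ne_zero h0.ne') (this.1.trans this.2.symm)

/-- In a reflexive space with an equivalent strictly convex norm, the intersection of a family of
contractive sets is contractive, provided it is nonempty. -/
theorem IsReflexiveSpace.isContractiveFor_sInter (hE : IsReflexiveSpace E) {N : Seminorm ℝ E}
    (hN : IsStrictlyConvexNorm N) (hNc : Continuous N) {C : ℝ} (hC : ∀ z, ‖z‖ ≤ C * N z)
    {𝓐 : Set (Set E)} (h𝓐 : ∀ A ∈ 𝓐, IsContractiveFor N A) (hne : (⋂₀ 𝓐).Nonempty) :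
    IsContractiveFor N (⋂₀ 𝓐) := by
  set F := ⋂₀ 𝓐
  let S := {g : E → E // (∀ c ∈ F, g c = c) ∧ ∀ x y, N (g x - g y) ≤ N (x - y)}
  -- `r f g` says that `g` shrinks all distances at least as much as `f`; Zorn yields a map whose
  -- distances cannot be shrunk further.
  let r : S → S → Prop := fun f g => ∀ x y, N (g.1 x - g.1 y) ≤ N (f.1 x - f.1 y)
  obtain ⟨c₀, hc₀⟩ := hne
  have hC0 : 0 ≤ C ∨ ∀ z, N z = 0 := by
    by_contra! h
    obtain ⟨h, z, hz⟩ := h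
    have hz' : 0 < N z := (apply_nonneg N z).lt_of_ne' hz
    nlinarith [hC z, norm_nonneg z]
  have : Nonempty S := ⟨⟨id, fun _ _ => rfl, fun _ _ => le_rfl⟩⟩
  obtain ⟨m, hm⟩ := exists_maximal_of_nonempty_chains_bounded (r := r) (by
    intro c hc hcne
    have := hcne.to_subtype
    -- An ultrafilter finer than the tails of the chain gives pointwise weak limits; weak lower
    -- semicontinuity of `N` makes the limit map an upper bound.
    let l : Filter c := ⨅ f : c, 𝓟 {g : c | r f g}
    have hl : l.NeBot := by
      refine iInf_neBot_of_directed' ?_ fun f => ?_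
      · intro f g
        have trans : ∀ {a b d : S}, r a b → r b d → r a d :=
          fun h₁ h₂ x y => (h₂ x y).trans (h₁ x y)
        rcases eq_or_ne f g with rfl | hfg
        · exact ⟨f, le_rfl, le_rfl⟩
        rcases hc f.2 g.2 (fun h => hfg (Subtype.ext h)) with h | h
        · exact ⟨g, principal_mono.2 fun k hk => trans h hk, le_rfl⟩
        · exact ⟨f, le_rfl, principal_mono.2 fun k hk => trans h hk⟩
      · exact principal_neBot_iff.2 ⟨f, fun x y => le_rfl⟩
    let U := Ultrafilter.of l
    have hU : ∀ f : c, ∀ᶠ g : c in (U : Filter c), r f g := fun f =>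
      Ultrafilter.of_le l (mem_iInf_of_mem f (mem_principal_self _))
    have hlim : ∀ x, ∃ z, WeakLim (U : Filter c) (fun g => g.1.1 x) z := fun x => by
      refine hE.exists_weakLim U (C := C * N (x - c₀) + ‖c₀‖) (Eventually.of_forall fun g => ?_)
      have h1 := g.1.2.2 x c₀
      rw [g.1.2.1 c₀ hc₀] at h1
      have h2 := hC (g.1.1 x - c₀)
      have h3 := norm_le_norm_sub_add (g.1.1 x) c₀
      rcases hC0 with h | h
      · linarith [mul_le_mul_of_nonneg_left h1 h]
      · simp only [h] at h2 ⊢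
        linarith
    choose h hh using hlim
    have key : ∀ f ∈ c, ∀ x y, N (h x - h y) ≤ N (f.1 x - f.1 y) := fun f hf x y =>
      ((hh x).sub (hh y)).seminorm_le hNc ((hU ⟨f, hf⟩).mono fun g hg => hg x y)
    obtain ⟨f₀, hf₀⟩ := hcne
    exact ⟨⟨h, fun d hd => (hh d).eq_of_const (Eventually.of_forall fun g => g.1.2.1 d hd),
      fun x y => (key f₀ hf₀ x y).trans (f₀.2.2 x y)⟩, key⟩)
    (fun h₁ h₂ x y => (h₂ x y).trans (h₁ x y))
  refine ⟨m.1, fun x => ?_, m.2.1, m.2.2⟩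
  refine mem_sInter.2 fun A hA => ?_
  obtain ⟨P, hPA, hPid, hP⟩ := h𝓐 A hA
  have hPF : ∀ c ∈ F, P c = c := fun c hc => hPid c (hc A hA)
  -- Both `P ∘ m` and its average with `m` are competitors, so by maximality they preserve the
  -- distances of `m`. Strict convexity then forces `P (m x) = m x`, the common fixed point `c₀`
  -- serving as origin.
  let g₁ : S := ⟨fun x => P (m.1 x), fun c hc => by
    change P (m.1 c) = c
    rw [m.2.1 c hc, hPF c hc],
    fun x y => (hP _ _).trans (m.2.2 x y)⟩
  have hmid : ∀ x y, N ((1 / 2 : ℝ) • (m.1 x + P (m.1 x)) - (1 / 2 : ℝ) • (m.1 y + P (m.1 y))) ≤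
      N (m.1 x - m.1 y) := fun x y => by
    have e : (1 / 2 : ℝ) • (m.1 x + P (m.1 x)) - (1 / 2 : ℝ) • (m.1 y + P (m.1 y)) =
      (1 / 2 : ℝ) • ((m.1 x - m.1 y) + (P (m.1 x) - P (m.1 y))) := by module
    rw [e, map_smul_eq_mul]
    have h1 := map_add_le_add N (m.1 x - m.1 y) (P (m.1 x) - P (m.1 y))
    have h2 := hP (m.1 x) (m.1 y)
    norm_num
    linarith
  let g₂ : S := ⟨fun x => (1 / 2 : ℝ) • (m.1 x + P (m.1 x)),
    fun c hc => by
      change (1 / 2 : ℝ) • (m.1 c + P (m.1 c)) = c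
      rw [m.2.1 c hc, hPF c hc]; module,
    fun x y => (hmid x y).trans (m.2.2 x y)⟩
  have e₁ : N (m.1 x - m.1 c₀) ≤ N (P (m.1 x) - P (m.1 c₀)) :=
    hm g₁ (fun x y => hP _ _) x c₀
  have e₂ := hm g₂ hmid x c₀
  have := hN.eq_of_midpoint (u := m.1 x - m.1 c₀) (v := P (m.1 x) - P (m.1 c₀))
    (le_antisymm e₁ (hP _ _)) (by
      have e : (1 / 2 : ℝ) • ((m.1 x - m.1 c₀) + (P (m.1 x) - P (m.1 c₀))) =
        (1 / 2 : ℝ) • (m.1 x + P (m.1 x)) - (1 / 2 : ℝ) • (m.1 c₀ + P (m.1 c₀)) := by module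
      rw [e]
      exact le_antisymm (hmid x c₀) e₂)
  rw [m.2.1 c₀ hc₀, hPF c₀ hc₀] at this
  rw [sub_left_inj.1 this]
  exact hPA _

/-- A closed convex set which is contractive with respect to norms approximating the given one is
contractive. -/
theorem IsReflexiveSpace.isContractive_of_tendsto (hE : IsReflexiveSpace E)
    {N : ℕ → Seminorm ℝ E} {s : ℕ → ℝ} (hs_nonneg : ∀ n, 0 ≤ s n) (hs : Tendsto s atTop (𝓝 0))
    (hequiv : ∀ n z, (1 - s n) * N n z ≤ ‖z‖ ∧ ‖z‖ ≤ (1 + s n) * N n z)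
    {F : Set E} (hF : Convex ℝ F) (hFc : IsClosed F) (hne : F.Nonempty)
    (h : ∀ᶠ n in atTop, IsContractiveFor (N n) F) : IsContractive F := by
  have hP : ∀ n, ∃ P : E → E, IsContractiveFor (N n) F →
      (∀ x, P x ∈ F) ∧ (∀ x ∈ F, P x = x) ∧ ∀ x y, N n (P x - P y) ≤ N n (x - y) := fun n => by
    by_cases hn : IsContractiveFor (N n) F
    · exact hn.imp fun P hP _ => hP
    -- Dummy value for the indices where `F` is not contractive; the ultrafilter ignores them.
    · exact ⟨id, fun h => absurd h hn⟩
  choose P hP using hP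
  let U : Ultrafilter ℕ := Ultrafilter.of atTop
  have hU : (U : Filter ℕ) ≤ atTop := Ultrafilter.of_le _
  have hlt : ∀ᶠ n in atTop, s n < 1 / 2 := hs.eventually_lt_const (by norm_num)
  have key : ∀ᶠ n in (U : Filter ℕ), (∀ x, P n x ∈ F) ∧ (∀ x ∈ F, P n x = x) ∧ s n < 1 / 2 ∧
      ∀ x y, ‖P n x - P n y‖ ≤ (1 + s n) / (1 - s n) * ‖x - y‖ := by
    refine hU ?_
    filter_upwards [h, hlt] with n hn hsn
    obtain ⟨h1, h2, h3⟩ := hP n hn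
    refine ⟨h1, h2, hsn, fun x y => ?_⟩
    have h4 := (hequiv n (P n x - P n y)).2
    have h5 := (hequiv n (x - y)).1
    have h6 : 0 < 1 - s n := by linarith
    have h7 : N n (x - y) ≤ ‖x - y‖ / (1 - s n) := by rw [le_div_iff₀ h6]; linarith
    calc _ ≤ (1 + s n) * N n (x - y) :=
          h4.trans (mul_le_mul_of_nonneg_left (h3 x y) (by linarith [hs_nonneg n]))
      _ ≤ (1 + s n) * (‖x - y‖ / (1 - s n)) :=
          mul_le_mul_of_nonneg_left h7 (by linarith [hs_nonneg n])
      _ = _ := by ring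
  obtain ⟨c₀, hc₀⟩ := hne
  have hlim : ∀ x, ∃ z, WeakLim (U : Filter ℕ) (fun n => P n x) z := fun x => by
    refine hE.exists_weakLim U (C := 3 * ‖x - c₀‖ + ‖c₀‖) ?_
    filter_upwards [key] with n ⟨_, h2, h3, h4⟩
    have h5 := h4 x c₀
    rw [h2 c₀ hc₀] at h5
    have h6 : (1 + s n) / (1 - s n) ≤ 3 := by
      rw [div_le_iff₀ (by linarith)]
      linarith
    have h7 := norm_le_norm_sub_add (P n x) c₀
    linarith [mul_le_mul_of_nonneg_right h6 (norm_nonneg (x - c₀))]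
  choose Q hQ using hlim
  refine ⟨Q, fun x => (hQ x).mem hF hFc (key.mono fun n hn => hn.1 x),
    fun x hx => (hQ x).eq_of_const (key.mono fun n hn => hn.2.1 x hx), fun x y => ?_⟩
  refine ((hQ x).sub (hQ y)).norm_le_of_tendsto
    (a := fun n => (1 + s n) / (1 - s n) * ‖x - y‖) ?_ (key.mono fun n hn => hn.2.2.2 x y)
  have : Tendsto (fun n => (1 + s n) / (1 - s n) * ‖x - y‖) atTop
      (𝓝 ((1 + 0) / (1 - 0) * ‖x - y‖)) :=
    ((tendsto_const_nhds.add hs).div (tendsto_const_nhds.sub hs) (by norm_num)).mul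
      tendsto_const_nhds
  simpa using this.mono_left hU

end StrictlyConvex

/-! ### A compact body, the image of the `ℓ²` ball, smooth at its support points. -/

section SmoothBody

/-- A linear form is maximal on a disc only in the direction of its gradient: testing at the
rescaled gradient `(t * p, t * q)` gives equality in Cauchy–Schwarz. -/
theorem mul_eq_mul_of_forall_le {a b p q : ℝ}
    (h : ∀ x y : ℝ, x ^ 2 + y ^ 2 ≤ a ^ 2 + b ^ 2 → x * p + y * q ≤ a * p + b * q) :
    a * q = b * p := by
  rcases (add_nonneg (sq_nonneg p) (sq_nonneg q)).eq_or_lt' with h0 | h0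
  · have hp : p = 0 := by nlinarith [sq_nonneg p, sq_nonneg q]
    have hq : q = 0 := by nlinarith [sq_nonneg p, sq_nonneg q]
    simp [hp, hq]
  set t := √((a ^ 2 + b ^ 2) / (p ^ 2 + q ^ 2)) with ht
  have ht0 : 0 ≤ t := Real.sqrt_nonneg _
  have ht2 : t ^ 2 * (p ^ 2 + q ^ 2) = a ^ 2 + b ^ 2 := by
    rw [ht, Real.sq_sqrt (by positivity), div_mul_cancel₀ _ h0.ne']
  have h1 := h (t * p) (t * q) (by linarith)
  have h2 : 0 ≤ t * (p ^ 2 + q ^ 2) := by positivity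
  have h3 : (t * (p ^ 2 + q ^ 2)) ^ 2 ≤ (a * p + b * q) ^ 2 :=
    pow_le_pow_left₀ h2 (by linarith) 2
  have h4 : (t * (p ^ 2 + q ^ 2)) ^ 2 = (a ^ 2 + b ^ 2) * (p ^ 2 + q ^ 2) := by
    rw [← ht2]; ring
  have h5 : (a * q - b * p) ^ 2 ≤ 0 := by nlinarith
  have h6 : a * q - b * p = 0 := by nlinarith [sq_nonneg (a * q - b * p)]
  linarith

/-- The unit ball of `ℓ²`, as a set of sequences. -/
def sqSummableBall : Set (ℕ → ℝ) := {a | ∀ s : Finset ℕ, ∑ i ∈ s, a i ^ 2 ≤ 1}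

theorem zero_mem_sqSummableBall : (0 : ℕ → ℝ) ∈ sqSummableBall := fun s => by simp

theorem abs_le_one_of_mem_sqSummableBall {a : ℕ → ℝ} (ha : a ∈ sqSummableBall) (i : ℕ) :
    |a i| ≤ 1 := by
  have := ha {i}
  rw [Finset.sum_singleton] at this
  exact (sq_le_one_iff_abs_le_one _).1 this

theorem isCompact_sqSummableBall : IsCompact sqSummableBall := by
  refine (isCompact_univ_pi fun _ : ℕ => isCompact_Icc (a := (-1 : ℝ)) (b := 1)).of_isClosed_subset
    ?_ fun a ha i _ => abs_le.1 (abs_le_one_of_mem_sqSummableBall ha i)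
  rw [sqSummableBall, ofPred_forall]
  exact isClosed_iInter fun s => isClosed_le (by fun_prop) continuous_const

theorem add_single_add_single_mem_sqSummableBall {e : ℕ → ℝ} (he : e ∈ sqSummableBall) {n m : ℕ}
    (hnm : n ≠ m) {x y : ℝ} (hxy : x ^ 2 + y ^ 2 ≤ e n ^ 2 + e m ^ 2) :
    e + (Pi.single n (x - e n) + Pi.single m (y - e m)) ∈ sqSummableBall := by
  intro s
  set a := e + (Pi.single n (x - e n) + Pi.single m (y - e m)) with ha
  have han : a n = x := by simp [ha, hnm]
  have ham : a m = y := by simp [ha, hnm.symm]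
  have hai : ∀ i, i ≠ n → i ≠ m → a i = e i := fun i h1 h2 => by simp [ha, h1, h2]
  have hsub : ∑ i ∈ s, a i ^ 2 ≤ ∑ i ∈ insert n (insert m s), a i ^ 2 :=
    Finset.sum_le_sum_of_subset_of_nonneg
      (fun i hi => Finset.mem_insert_of_mem (Finset.mem_insert_of_mem hi))
      fun i _ _ => sq_nonneg _
  have hsplit : ∀ b : ℕ → ℝ, ∑ i ∈ insert n (insert m s), b i ^ 2 =
      b n ^ 2 + (b m ^ 2 + ∑ i ∈ (s.erase m).erase n, b i ^ 2) := fun b => by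
    have hset : insert n (insert m s) = insert n (insert m ((s.erase m).erase n)) := by
      ext i
      simp only [Finset.mem_insert, Finset.mem_erase]
      tauto
    rw [hset, Finset.sum_insert (by simp [hnm]), Finset.sum_insert (by simp)]
  have hrest : ∑ i ∈ (s.erase m).erase n, a i ^ 2 = ∑ i ∈ (s.erase m).erase n, e i ^ 2 :=
    Finset.sum_congr rfl fun i hi => by
      rw [Finset.mem_erase, Finset.mem_erase] at hi
      rw [hai i hi.1 hi.2.1]
  have h1 := he (insert n (insert m s))
  rw [hsplit] at h1
  rw [hsplit, hrest, han, ham] at hsub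
  linarith

variable {E : Type*} [NormedAddCommGroup E] [NormedSpace ℝ E]

/-- A separable Banach space contains arbitrarily small compact sets all of whose support points
are points of smoothness. -/
theorem exists_isCompact_smooth [CompleteSpace E] [TopologicalSpace.SeparableSpace E] {δ : ℝ}
    (hδ : 0 < δ) :
    ∃ K : Set E, IsCompact K ∧ (0 : E) ∈ K ∧ (∀ x ∈ K, ‖x‖ ≤ δ) ∧
      ∀ x ∈ K, ∀ f g : StrongDual ℝ E, f ≠ 0 → (∀ y ∈ K, f y ≤ f x) → (∀ y ∈ K, g y ≤ g x) →
        ∃ c : ℝ, g = c • f := by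
  obtain ⟨v, hv⟩ := TopologicalSpace.exists_dense_seq E
  -- Weights making `w` norm-summable with total at most `δ`, while keeping its span dense.
  let k : ℕ → ℝ := fun n => δ / 2 / 2 ^ n / (1 + ‖v n‖)
  have hk : ∀ n, 0 < k n := fun n => by positivity
  let w : ℕ → E := fun n => k n • v n
  have hw : ∀ n, ‖w n‖ ≤ δ / 2 / 2 ^ n := fun n => by
    have h1 : 0 < 1 + ‖v n‖ := by positivity
    rw [norm_smul, Real.norm_of_nonneg (hk n).le, div_mul_eq_mul_div, div_le_iff₀ h1]
    exact mul_le_mul_of_nonneg_left (by linarith) (by positivity)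
  have hbound : ∀ a ∈ sqSummableBall, ∀ n, ‖a n • w n‖ ≤ δ / 2 / 2 ^ n := fun a ha n => by
    rw [norm_smul, Real.norm_eq_abs]
    exact (mul_le_of_le_one_left (norm_nonneg _) (abs_le_one_of_mem_sqSummableBall ha n)).trans
      (hw n)
  have hsumm : ∀ a ∈ sqSummableBall, Summable fun n => a n • w n := fun a ha =>
    Summable.of_norm_bounded (summable_geometric_two' δ) (hbound a ha)
  let T : (ℕ → ℝ) → E := fun a => ∑' n, a n • w n
  have hTc : ContinuousOn T sqSummableBall :=
    continuousOn_tsum (fun n => by fun_prop) (summable_geometric_two' δ)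
      fun n a ha => hbound a ha n
  refine ⟨T '' sqSummableBall, isCompact_sqSummableBall.image_of_continuousOn hTc,
    ⟨0, zero_mem_sqSummableBall, by simp [T]⟩, ?_, ?_⟩
  · rintro _ ⟨a, ha, rfl⟩
    exact tsum_of_norm_bounded (hasSum_geometric_two' δ) (hbound a ha)
  rintro _ ⟨e, he, rfl⟩ f g hf0 hf hg
  have key : ∀ f : StrongDual ℝ E, (∀ y ∈ T '' sqSummableBall, f y ≤ f (T e)) →
      ∀ n m, n ≠ m → ∀ x y : ℝ, x ^ 2 + y ^ 2 ≤ e n ^ 2 + e m ^ 2 →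
        x * f (w n) + y * f (w m) ≤ e n * f (w n) + e m * f (w m) := by
    intro f hf n m hnm x y hxy
    have hmem := add_single_add_single_mem_sqSummableBall he hnm hxy
    have hsum : ∀ n (t : ℝ), HasSum (fun i => (Pi.single n t : ℕ → ℝ) i • w i) (t • w n) :=
      fun n t => by
        simpa using hasSum_single (f := fun i => (Pi.single n t : ℕ → ℝ) i • w i) n
          fun i hi => by simp [hi]
    have hT : T (e + (Pi.single n (x - e n) + Pi.single m (y - e m))) =
        T e + ((x - e n) • w n + (y - e m) • w m) := by
      refine HasSum.tsum_eq ?_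
      simp only [Pi.add_apply, add_smul]
      exact (hsumm e he).hasSum.add ((hsum n _).add (hsum m _))
    have := hf _ ⟨_, hmem, rfl⟩
    rw [hT] at this
    simp only [map_add, map_smul, smul_eq_mul] at this
    linarith
  -- Varying two coordinates at a time shows that the values of `f` on `w` are proportional to `e`,
  -- which determines `f` up to a scalar.
  have hprop : ∀ f : StrongDual ℝ E, (∀ y ∈ T '' sqSummableBall, f y ≤ f (T e)) →
      ∀ n m, e n * f (w m) = e m * f (w n) := by
    intro f hf n m
    rcases eq_or_ne n m with rfl | hnm
    · rfl
    · exact mul_eq_mul_of_forall_le (key f hf n m hnm)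
  have hext : ∀ φ ψ : StrongDual ℝ E, (∀ n, φ (w n) = ψ (w n)) → φ = ψ := by
    intro φ ψ h
    refine ContinuousLinearMap.ext fun x => congrFun (hv.equalizer φ.continuous ψ.continuous
      (funext fun n => ?_)) x
    have := h n
    simp only [w, map_smul, smul_eq_mul] at this
    exact mul_left_cancel₀ (hk n).ne' this
  have he0 : ∃ m, e m ≠ 0 := by
    by_contra! h
    have hT0 : T e = 0 := by simp [T, h]
    apply hf0
    refine hext f 0 fun n => ?_
    have hs : ∀ t : ℝ, |t| = 1 → t * f (w n) ≤ 0 := fun t ht => by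
      have hmem : (Pi.single n t : ℕ → ℝ) ∈ sqSummableBall := fun s => by
        calc ∑ i ∈ s, (Pi.single n t : ℕ → ℝ) i ^ 2
            ≤ ∑ i ∈ insert n s, (Pi.single n t : ℕ → ℝ) i ^ 2 :=
              Finset.sum_le_sum_of_subset_of_nonneg (Finset.subset_insert _ _)
                fun i _ _ => sq_nonneg _
          _ = t ^ 2 := by
              rw [Finset.sum_eq_single_of_mem n (Finset.mem_insert_self _ _)]
              · simp
              · intro i _ hi
                simp [hi]
          _ ≤ 1 := by rw [← sq_abs, ht]; norm_num
      have h1 := hf _ ⟨_, hmem, rfl⟩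
      have h2 : T (Pi.single n t) = t • w n := by
        simp only [T]
        rw [tsum_eq_single n]
        · simp
        · intro i hi
          simp [hi]
      rw [hT0, h2] at h1
      simpa using h1
    have h1 := hs 1 (by norm_num)
    have h2 := hs (-1) (by norm_num)
    simp only [zero_apply]
    linarith
  obtain ⟨m, hm⟩ := he0
  have hfm : f (w m) ≠ 0 := by
    intro h
    apply hf0
    refine hext f 0 fun n => ?_
    have := hprop f hf m n
    rw [h, mul_zero] at this
    simpa [hm] using this
  refine ⟨g (w m) / f (w m), hext _ _ fun n => ?_⟩
  have h1 := hprop f hf m n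
  have h2 := hprop g hg m n
  simp only [smul_apply, smul_eq_mul]
  rw [div_mul_eq_mul_div, eq_div_iff hfm]
  apply mul_left_cancel₀ hm
  calc e m * (g (w n) * f (w m)) = (e m * g (w n)) * f (w m) := by ring
    _ = g (w m) * (e n * f (w m)) := by rw [h2]; ring
    _ = e m * (g (w m) * f (w n)) := by rw [← h1]; ring

end SmoothBody

/-! ### Contractive half-spaces and smooth support points. -/

section HalfSpaces

theorem IsExistenceSet.isClosed {E : Type*} [NormedAddCommGroup E] {F : Set E} (hF : IsExistenceSet F) : IsClosed F := by
  refine isClosed_of_closure_subset fun x hx => ?_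
  obtain ⟨d, hd, h⟩ := hF x
  have : ‖d - x‖ ≤ 0 := by
    refine le_of_forall_pos_le_add fun ε hε => ?_
    obtain ⟨c, hc, hxc⟩ := Metric.mem_closure_iff.1 hx (ε / 2) (by positivity)
    rw [dist_eq_norm] at hxc
    have h1 := norm_sub_le_norm_sub_add_norm_sub d c x
    rw [norm_sub_rev c x] at h1
    linarith [h c hc]
  rwa [← sub_eq_zero.1 (norm_le_zero_iff.1 this)]

variable {E : Type*} [NormedAddCommGroup E] [NormedSpace ℝ E]

/-- A half-space which is an existence set is contractive. -/
theorem isContractive_setOf_le {f : StrongDual ℝ E} (hf : f ≠ 0) {d : ℝ}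
    (h : IsExistenceSet {x | f x ≤ d}) : IsContractive {x | f x ≤ d} := by
  obtain ⟨x₁, hx₁⟩ : ∃ x, f x ≠ 0 := by
    by_contra! h0
    exact hf (ContinuousLinearMap.ext h0)
  let z := ((d + 1) / f x₁) • x₁
  have hz : f z = d + 1 := by simp [z, div_mul_cancel₀ _ hx₁]
  obtain ⟨w, hw, hwc⟩ := h z
  have hw' : f w ≤ d := hw
  -- Sliding `w` towards `z` until it meets the hyperplane keeps the coapproximation inequality, by
  -- convexity of the norm.
  obtain ⟨w', hw'd, hw'c⟩ : ∃ w', f w' = d ∧ ∀ c, f c ≤ d → ‖w' - c‖ ≤ ‖z - c‖ := by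
    have hpos : 0 < d + 1 - f w := by linarith
    set t := (d - f w) / (d + 1 - f w) with ht
    have ht0 : 0 ≤ t := div_nonneg (by linarith) hpos.le
    have ht1 : t ≤ 1 := (div_le_one hpos).2 (by linarith)
    refine ⟨w + t • (z - w), ?_, fun c hc => ?_⟩
    · simp only [map_add, map_smul, map_sub, smul_eq_mul, hz]
      rw [ht, div_mul_cancel₀ _ hpos.ne']
      ring
    · have e : w + t • (z - w) - c = (1 - t) • (w - c) + t • (z - c) := by module
      rw [e]
      refine (norm_add_le _ _).trans ?_
      rw [norm_smul, norm_smul, Real.norm_of_nonneg ht0, Real.norm_of_nonneg (sub_nonneg.2 ht1)]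
      nlinarith [hwc c hc]
  set u := z - w' with hu
  have hfu : f u = 1 := by rw [hu, map_sub, hz, hw'd]; ring
  -- The linear projection onto `ker f` along `u` is nonexpansive: test `w'` against the point `z -
  -- (f y)⁻¹ • y` of the hyperplane.
  have hQ : ∀ y, ‖y - f y • u‖ ≤ ‖y‖ := fun y => by
    rcases eq_or_ne (f y) 0 with h0 | h0
    · simp [h0]
    have h1 := hw'c (z - (f y)⁻¹ • y) (by simp [hz, inv_mul_cancel₀ h0])
    have e1 : w' - (z - (f y)⁻¹ • y) = (f y)⁻¹ • (y - f y • u) := by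
      rw [smul_sub, smul_smul, inv_mul_cancel₀ h0, hu]; module
    rw [e1, sub_sub_cancel, norm_smul, norm_smul] at h1
    exact le_of_mul_le_mul_left h1 (norm_pos_iff.2 (inv_ne_zero h0))
  have hQt : ∀ y t, 0 ≤ t → t ≤ f y → ‖y - t • u‖ ≤ ‖y‖ := fun y t ht0 ht => by
    rcases ht0.eq_or_lt with rfl | ht0
    · simp
    have hy : 0 < f y := ht0.trans_le ht
    have h1 : t / f y ≤ 1 := (div_le_one hy).2 ht
    have h2 : 0 ≤ t / f y := by positivity
    have e : y - t • u = (1 - t / f y) • y + (t / f y) • (y - f y • u) := by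
      rw [smul_sub (t / f y), smul_smul, div_mul_cancel₀ _ hy.ne']; module
    rw [e]
    refine (norm_add_le _ _).trans ?_
    rw [norm_smul, norm_smul, Real.norm_of_nonneg h2, Real.norm_of_nonneg (sub_nonneg.2 h1)]
    nlinarith [hQ y]
  let P : E → E := fun x => x - max (f x - d) 0 • u
  have key : ∀ x y, f y ≤ f x → ‖P x - P y‖ ≤ ‖x - y‖ := fun x y hxy => by
    have e : P x - P y = (x - y) - (max (f x - d) 0 - max (f y - d) 0) • u := by
      simp only [P]; module
    rw [e]
    refine hQt _ _ (sub_nonneg.2 (max_le_max (by linarith) le_rfl)) ?_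
    rw [map_sub, sub_le_iff_le_add]
    refine max_le ?_ ?_
    · linarith [le_max_left (f y - d) 0]
    · linarith [le_max_right (f y - d) 0]
  refine ⟨P, fun x => ?_, fun x hx => ?_, fun x y => ?_⟩
  · simp only [P, mem_ofPred_eq, map_sub, map_smul, hfu, smul_eq_mul, mul_one]
    linarith [le_max_left (f x - d) 0]
  · have : max (f x - d) 0 = 0 := max_eq_right (sub_nonpos.2 hx)
    simp [P, this]
  · change ‖P x - P y‖ ≤ ‖x - y‖
    rcases le_total (f y) (f x) with hxy | hxy
    · exact key x y hxy
    · rw [norm_sub_rev, norm_sub_rev x]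
      exact key y x hxy

/-- The supporting half-space at a smooth point of a convex existence set with interior points is
an existence set. -/
theorem IsReflexiveSpace.isExistenceSet_setOf_le (hE : IsReflexiveSpace E) {F : Set E}
    (hF : Convex ℝ F) (hFe : IsExistenceSet F) {x₀ p : E} (hx₀ : x₀ ∈ F) (hp : p ∈ F)
    {f : StrongDual ℝ E} (hf : ∀ y ∈ F, f y ≤ f x₀) (hfp : f p < f x₀)
    (hsm : ∀ g : StrongDual ℝ E, (∀ y ∈ F, g y ≤ g x₀) → ∃ c : ℝ, g = c • f) :
    IsExistenceSet {x | f x ≤ f x₀} := by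
  intro z
  -- Coapproximants to points approaching `x₀`, magnified about `x₀` by `n + 1`, so that `F` grows
  -- to its tangent cone.
  have hex : ∀ n : ℕ, ∃ d ∈ F, ∀ c ∈ F,
      ‖(n + 1 : ℝ) • (d - x₀) - (n + 1 : ℝ) • (c - x₀)‖ ≤ ‖(z - x₀) - (n + 1 : ℝ) • (c - x₀)‖ := by
    intro n
    have hn : (n + 1 : ℝ) ≠ 0 := by positivity
    obtain ⟨d, hd, h⟩ := hFe (x₀ + (n + 1 : ℝ)⁻¹ • (z - x₀))
    refine ⟨d, hd, fun c hc => ?_⟩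
    have e1 : (n + 1 : ℝ) • (d - x₀) - (n + 1 : ℝ) • (c - x₀) = (n + 1 : ℝ) • (d - c) := by module
    have e2 : (z - x₀) - (n + 1 : ℝ) • (c - x₀) =
        (n + 1 : ℝ) • (x₀ + (n + 1 : ℝ)⁻¹ • (z - x₀) - c) := by
      rw [add_sub_right_comm, smul_add, smul_smul, mul_inv_cancel₀ hn]; module
    rw [e1, e2, norm_smul, norm_smul]
    exact mul_le_mul_of_nonneg_left (h c hc) (norm_nonneg _)
  choose d hd hdc using hex
  let U : Ultrafilter ℕ := Ultrafilter.of atTop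
  have hU : (U : Filter ℕ) ≤ atTop := Ultrafilter.of_le _
  obtain ⟨y, hy⟩ := hE.exists_weakLim U (u := fun n : ℕ => (n + 1 : ℝ) • (d n - x₀))
    (C := ‖z - x₀‖) (Eventually.of_forall fun n => by simpa using hdc n x₀ hx₀)
  have hcone : ∀ c ∈ F, ∀ t : ℝ, 0 < t → ‖y - t • (c - x₀)‖ ≤ ‖(z - x₀) - t • (c - x₀)‖ := by
    intro c hc t ht
    refine (hy.sub (WeakLim.const _ (t • (c - x₀)))).norm_le (hU ?_)
    filter_upwards [eventually_ge_atTop ⌈t⌉₊] with n hn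
    have hn' : t ≤ n := (Nat.le_ceil t).trans (by exact_mod_cast hn)
    have hn0 : (0 : ℝ) < n + 1 := by positivity
    have hmem : x₀ + (t / (n + 1)) • (c - x₀) ∈ F :=
      hF.add_smul_sub_mem hx₀ hc ⟨by positivity, (div_le_one hn0).2 (by linarith)⟩
    have := hdc n _ hmem
    rwa [add_sub_cancel_left, smul_smul, mul_div_cancel₀ _ hn0.ne'] at this
  have hG : Convex ℝ ((fun c => c - x₀) '' F) := by
    simpa [sub_eq_add_neg, add_comm] using! hF.translate (-x₀)
  -- Smoothness enters here: a functional separating `v` from the cone supports `F` at `x₀`, hence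
  -- is a multiple of `f`, nonnegative because of `p`.
  have hdense : ∀ v, f v ≤ 0 → v ∈ closure (ConvexCone.hull ℝ ((fun c => c - x₀) '' F) : Set E) := by
    intro v hv
    by_contra hv'
    obtain ⟨g, a, hg, ha⟩ :=
      geometric_hahn_banach_closed_point (ConvexCone.convex _).closure isClosed_closure hv'
    have hgt : ∀ c ∈ F, ∀ t : ℝ, 0 < t → t * (g c - g x₀) < a := fun c hc t ht => by
      have := hg _ (subset_closure ((ConvexCone.mem_hull_of_convex hG).2
        ⟨t, ht, c - x₀, ⟨c, hc, rfl⟩, rfl⟩))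
      simpa using this
    have ha0 : 0 < a := by simpa using hgt x₀ hx₀ 1 one_pos
    have hgle : ∀ c ∈ F, g c ≤ g x₀ := fun c hc => by
      by_contra! hlt
      have hpos : 0 < g c - g x₀ := by linarith
      have := hgt c hc (a / (g c - g x₀)) (by positivity)
      rw [div_mul_cancel₀ _ hpos.ne'] at this
      exact lt_irrefl _ this
    obtain ⟨k, rfl⟩ := hsm g hgle
    have h1 := hgle p hp
    simp only [smul_apply, smul_eq_mul] at h1 ha
    have hk : 0 ≤ k := by
      by_contra! hk
      nlinarith
    nlinarith
  refine ⟨x₀ + y, ?_, fun c hc => ?_⟩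
  · have hy0 : y ∈ {v | f v ≤ 0} := hy.mem (convex_halfSpace_le f.toLinearMap.isLinear 0)
      (isClosed_le f.continuous continuous_const) (Eventually.of_forall fun n => by
        have h1 := hf _ (hd n)
        have h2 : (0 : ℝ) ≤ n + 1 := by positivity
        simp only [mem_ofPred_eq, map_smul, map_sub, smul_eq_mul]
        exact mul_nonpos_of_nonneg_of_nonpos h2 (by linarith))
    have hy1 : f y ≤ 0 := hy0
    simp only [mem_ofPred_eq, map_add]
    linarith
  · have hcl : IsClosed {v | ‖y - v‖ ≤ ‖(z - x₀) - v‖} :=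
      isClosed_le (by fun_prop) (by fun_prop)
    have hsub : (ConvexCone.hull ℝ ((fun c => c - x₀) '' F) : Set E) ⊆ {v | ‖y - v‖ ≤ ‖(z - x₀) - v‖} := by
      intro v hv
      obtain ⟨t, ht, _, ⟨c, hc, rfl⟩, rfl⟩ := (ConvexCone.mem_hull_of_convex hG).1 hv
      exact hcone c hc t ht
    have hc' : f c ≤ f x₀ := hc
    have h1 : ‖y - (c - x₀)‖ ≤ ‖(z - x₀) - (c - x₀)‖ :=
      closure_minimal hsub hcl (hdense (c - x₀) (by rw [map_sub]; linarith))
    have e : x₀ + y - c = y - (c - x₀) := by abel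
    rwa [sub_sub_sub_cancel_right, ← e] at h1

/-- A closed convex set with interior points is separated from each exterior point by a
supporting half-space at a smooth point. -/
theorem exists_smooth_support_lt [CompleteSpace E] [TopologicalSpace.SeparableSpace E] {F : Set E}
    (hF : Convex ℝ F) (hFc : IsClosed F) {p z : E} (hp : p ∈ interior F) (hz : z ∉ F) :
    ∃ x₀ ∈ F, ∃ f : StrongDual ℝ E, ‖f‖ = 1 ∧ (∀ y ∈ F, f y ≤ f x₀) ∧ f p < f x₀ ∧ f x₀ < f z ∧
      ∀ g : StrongDual ℝ E, (∀ y ∈ F, g y ≤ g x₀) → ∃ c : ℝ, g = c • f := by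
  obtain ⟨r, hr, hball⟩ := Metric.isOpen_iff.1 isOpen_interior p hp
  obtain ⟨η, hη, hη1, hηF⟩ : ∃ η : ℝ, 0 < η ∧ η ≤ 1 ∧
      ∀ t : ℝ, t ≤ 1 → p + t • (z - p) ∈ F → t ≤ 1 - η := by
    have hopen : IsOpen ((fun t : ℝ => p + t • (z - p)) ⁻¹' Fᶜ) :=
      hFc.isOpen_compl.preimage (by fun_prop)
    obtain ⟨η, hη, h⟩ := Metric.isOpen_iff.1 hopen 1 (by simpa using hz)
    refine ⟨min (η / 2) 1, by positivity, min_le_right _ _, fun t ht htF => ?_⟩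
    by_contra! hlt
    refine h (a := t) ?_ htF
    rw [Metric.mem_ball, Real.dist_eq, abs_lt]
    constructor <;> linarith [min_le_left (η / 2) 1]
  obtain ⟨K, hKc, hK0, hKδ, hKs⟩ := exists_isCompact_smooth (E := E) (δ := η * r / 3) (by positivity)
  have hδr : η * r / 3 < r := by nlinarith
  let φ : ℝ × E → E := fun q => p + q.1 • (z - p) + q.2
  have hφ : Continuous φ := by fun_prop
  have hBc : IsCompact ((Icc (0 : ℝ) 1 ×ˢ K) ∩ φ ⁻¹' (interior F)ᶜ) :=
    (isCompact_Icc.prod hKc).inter_right (isOpen_interior.isClosed_compl.preimage hφ)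
  -- First time `t₀` at which the translate of `K` moving from `p` to `z` leaves the interior of
  -- `F`.
  obtain ⟨⟨t₀, k₀⟩, ⟨⟨ht₀, hk₀⟩, hnot⟩, hmin⟩ := hBc.exists_isMinOn
    ⟨(1, 0), ⟨⟨by simp, hK0⟩, fun h => hz (interior_subset (by simpa [φ] using h))⟩⟩
    continuous_fst.continuousOn
  have hlt : ∀ t, 0 ≤ t → t < t₀ → ∀ k ∈ K, φ (t, k) ∈ interior F := by
    intro t h0 ht k hk
    by_contra hn
    have := hmin (show (t, k) ∈ _ from ⟨⟨⟨h0, ht.le.trans ht₀.2⟩, hk⟩, hn⟩)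
    exact absurd ht (not_lt.2 this)
  have ht₀pos : 0 < t₀ := by
    refine ht₀.1.lt_of_ne fun h => hnot ?_
    change t₀ ∈ Icc (0:ℝ) 1 at ht₀
    refine hball ?_
    simp only at h
    rw [mem_ball_iff_norm]
    simp only [φ, ← h, zero_smul, add_zero, add_sub_cancel_left]
    exact (hKδ _ hk₀).trans_lt hδr
  have hcl : ∀ k ∈ K, ∀ s : Set E, IsClosed s → interior F ⊆ s → φ (t₀, k) ∈ s := by
    intro k hk s hs hsub
    have h1 : Tendsto (fun t => φ (t, k)) (𝓝[<] t₀) (𝓝 (φ (t₀, k))) :=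
      ((hφ.comp (by fun_prop : Continuous fun t : ℝ => (t, k))).tendsto t₀).mono_left
        nhdsWithin_le_nhds
    refine hs.mem_of_tendsto h1 ?_
    filter_upwards [Ioo_mem_nhdsLT ht₀pos] with t ht
    exact hsub (hlt t ht.1.le ht.2 k hk)
  have hclF : ∀ k ∈ K, φ (t₀, k) ∈ F := fun k hk => hcl k hk F hFc interior_subset
  obtain ⟨f', hf'⟩ := geometric_hahn_banach_open_point hF.interior isOpen_interior hnot
  have hf'0 : f' ≠ 0 := by
    rintro rfl
    simpa using hf' p hp
  have hnf : 0 < ‖f'‖ := norm_pos_iff.2 hf'0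
  obtain ⟨f, hfn, hf⟩ : ∃ f : StrongDual ℝ E, ‖f‖ = 1 ∧
      ∀ a ∈ interior F, f a < f (φ (t₀, k₀)) := by
    refine ⟨‖f'‖⁻¹ • f', ?_, fun a ha => ?_⟩
    · rw [norm_smul, norm_inv, norm_norm, inv_mul_cancel₀ hnf.ne']
    · simp only [smul_apply, smul_eq_mul]
      exact mul_lt_mul_of_pos_left (hf' a ha) (inv_pos.2 hnf)
  set x₀ := φ (t₀, k₀) with hx₀
  have hF' : F ⊆ closure (interior F) := by
    rw [hF.closure_interior_eq_closure_of_nonempty_interior ⟨p, hp⟩]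
    exact subset_closure
  have hfF : ∀ y ∈ F, f y ≤ f x₀ := fun y hy =>
    closure_minimal (fun a ha => (hf a ha).le) (isClosed_le f.continuous continuous_const) (hF' hy)
  have hfr : f p + r ≤ f x₀ := by
    by_contra! hlt'
    have h1 : (f x₀ - f p) / r < ‖f‖ := by
      rw [hfn, div_lt_one hr]
      linarith
    obtain ⟨v, hv, hfv⟩ := f.exists_lt_apply_of_lt_opNorm h1
    rw [div_lt_iff₀ hr, Real.norm_eq_abs] at hfv
    have h2 : ∀ t : ℝ, |t| = r → t * f v < f x₀ - f p := fun t ht => by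
      have := hf (p + t • v) (hball (by
        rw [mem_ball_iff_norm, add_sub_cancel_left, norm_smul, Real.norm_eq_abs, ht]
        exact mul_lt_of_lt_one_right hr hv))
      rw [map_add, map_smul, smul_eq_mul] at this
      linarith
    have h3 := h2 r (abs_of_pos hr)
    have h4 := h2 (-r) (by rw [abs_neg, abs_of_pos hr])
    rcases abs_cases (f v) with ⟨h, -⟩ | ⟨h, -⟩ <;> rw [h] at hfv <;> linarith
  have hfx : f x₀ = f p + t₀ * (f z - f p) + f k₀ := by simp [hx₀, φ]
  have hfk : f k₀ ≤ η * r / 3 := by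
    have := f.le_opNorm k₀
    rw [hfn, one_mul] at this
    exact (le_abs_self _).trans (this.trans (hKδ _ hk₀))
  have ht₀η : t₀ ≤ 1 - η := hηF t₀ ht₀.2 (by simpa [φ] using hclF 0 hK0)
  -- The translate of `K` lies in `F` and touches at `x₀`, so support of `F` at `x₀` passes to
  -- support of `K` at `k₀`.
  have hKx : ∀ g : StrongDual ℝ E, (∀ y ∈ F, g y ≤ g x₀) → ∀ k ∈ K, g k ≤ g k₀ := by
    intro g hg k hk
    have := hg _ (hclF k hk)
    simpa [hx₀, φ] using this
  refine ⟨x₀, hclF k₀ hk₀, f, hfn, hfF, hf p hp, ?_, fun g hg => ?_⟩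
  -- Since `f z - f p ≥ 2 * r / 3` and `t₀ ≤ 1 - η`, the gap `f z - f x₀` is at least `2 * η * r / 3
  -- - η * r / 3 > 0`; hence the size `η * r / 3` of `K`.
  · have h0 : 0 < t₀ * (f z - f p) := by linarith
    have h1 : 0 < f z - f p := pos_of_mul_pos_right h0 ht₀pos.le
    have h2 : t₀ * (f z - f p) ≤ 1 * (f z - f p) := mul_le_mul_of_nonneg_right ht₀.2 h1.le
    have h3 : η * (f z - f p) ≤ (1 - t₀) * (f z - f p) :=
      mul_le_mul_of_nonneg_right (by linarith) h1.le
    have h4 : η * (2 * r / 3) ≤ η * (f z - f p) := by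
      refine mul_le_mul_of_nonneg_left ?_ hη.le
      nlinarith
    have : 0 < η * r := by positivity
    linarith
  · refine hKs k₀ hk₀ f g ?_ (hKx f hfF) (hKx g hg)
    rintro rfl
    simp at hfn

/-- In a separable reflexive space, a convex existence set with interior points is a countable
intersection of contractive half-spaces. -/
theorem IsReflexiveSpace.isCountableInterContractiveHalfSpaces [CompleteSpace E]
    [TopologicalSpace.SeparableSpace E] (hE : IsReflexiveSpace E) {F : Set E}
    (hF : Convex ℝ F) (hFe : IsExistenceSet F) (hint : (interior F).Nonempty) :
    IsCountableInterContractiveHalfSpaces F := by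
  obtain ⟨p, hp⟩ := hint
  have : SecondCountableTopology E := UniformSpace.secondCountable_of_separable E
  let S : Set (Set E) := {H | (IsHalfSpace H ∧ IsContractive H) ∧ F ⊆ H}
  have hS : ∀ z ∉ F, ∃ H ∈ S, z ∉ H := fun z hz => by
    obtain ⟨x₀, hx₀, f, hfn, hfF, hfp, hfz, hsm⟩ :=
      exists_smooth_support_lt hF hFe.isClosed hp hz
    refine ⟨{x | f x ≤ f x₀}, ⟨⟨⟨f, _, hfn, rfl⟩, isContractive_setOf_le ?_
      (hE.isExistenceSet_setOf_le hF hFe hx₀ (interior_subset hp) hfF hfp hsm)⟩, hfF⟩,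
      not_le.2 hfz⟩
    rintro rfl
    simp at hfn
  -- Lindelöf, applied to the open complements of the half-spaces, leaves a countable subfamily.
  obtain ⟨T, hTS, hTc, hTU⟩ := TopologicalSpace.isOpen_biUnion_countable S compl (by
    rintro H ⟨⟨⟨f, d, -, rfl⟩, -⟩, -⟩
    exact (isClosed_le f.continuous continuous_const).isOpen_compl)
  refine ⟨T, hTc, fun H hH => (hTS hH).1, Subset.antisymm ?_ fun z hz => ?_⟩
  · exact subset_sInter fun H hH => (hTS hH).2
  · by_contra hzF
    obtain ⟨H, hH, hzH⟩ := hS z hzF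
    have : z ∈ ⋃ i ∈ T, iᶜ := by
      rw [hTU]
      exact mem_biUnion hH hzH
    obtain ⟨H', hH', hz'⟩ := mem_iUnion₂.1 this
    exact hz' (hz H' hH')

end HalfSpaces

/-! ### The main theorem. -/

theorem theorem3p1 {X : Type*} [NormedAddCommGroup X] [NormedSpace ℝ X] [CompleteSpace X]
    (F : Set X) (hconv : Convex ℝ F) (hbdd : Bornology.IsBounded F) (hex : IsExistenceSet F)
    (hrefl : IsReflexiveSpace (closedSpan F))
    (hsep : TopologicalSpace.SeparableSpace (closedSpan F))
    (hint : (interior (inClosedSpan F)).Nonempty)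
    (N : ℕ → Seminorm ℝ (closedSpan F)) (s : ℕ → ℝ)
    (hN : ∀ n, IsStrictlyConvexNorm (N n))
    (hs_nonneg : ∀ n, 0 ≤ s n) (hs_lim : Tendsto s atTop (𝓝 0))
    (hequiv : ∀ n z, (1 - s n) * N n z ≤ ‖z‖ ∧ ‖z‖ ≤ (1 + s n) * N n z)
    (hfam : IsCountableInterContractiveHalfSpaces (inClosedSpan F) →
      IsCountableInterContractiveFor N (inClosedSpan F))
    (hcontr : IsContractive (closedSpan F : Set X)) :
    IsContractive F := by
  have hsub : F ⊆ closedSpan F := fun x hx =>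
    Submodule.le_topologicalClosure _ (Submodule.subset_span hx)
  have hconvZ : Convex ℝ (inClosedSpan F) :=
    hconv.linear_preimage (closedSpan F).subtype
  have hexZ : IsExistenceSet (inClosedSpan F) := fun x => by
    obtain ⟨d, hd, h⟩ := hex x
    exact ⟨⟨d, hsub hd⟩, hd, fun c hc => h c hc⟩
  have : CompleteSpace (closedSpan F) := inferInstance
  obtain ⟨𝓐, -, h𝓐, hF𝓐⟩ :=
    hfam (hrefl.isCountableInterContractiveHalfSpaces hconvZ hexZ hint)
  have hneZ : (inClosedSpan F).Nonempty := hint.mono interior_subset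
  obtain ⟨r, hr, hrid, hrc⟩ := hrefl.isContractive_of_tendsto hs_nonneg hs_lim hequiv hconvZ
    hexZ.isClosed hneZ (by
      filter_upwards [hs_lim.eventually_lt_const one_pos] with n hn
      have hNc : Continuous (N n) := by
        have hpos : 0 < 1 - s n := by linarith
        refine Seminorm.continuous (r := 1) ?_
        filter_upwards [Metric.ball_mem_nhds (0 : closedSpan F) hpos] with z hz
        rw [mem_ball_zero_iff] at hz
        rw [Seminorm.mem_ball_zero]
        exact lt_of_mul_lt_mul_left (by linarith [(hequiv n z).1]) hpos.le
      rw [hF𝓐]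
      exact hrefl.isContractiveFor_sInter (hN n) hNc (fun z => (hequiv n z).2)
        (fun A hA => (h𝓐 A hA).2 n) (hF𝓐 ▸ hneZ))
  obtain ⟨P, hP, hPid, hPc⟩ := hcontr
  refine ⟨fun x => r ⟨P x, hP x⟩, fun x => hr _, fun x hx => ?_, fun x y => ?_⟩
  · have : (⟨P x, hP x⟩ : closedSpan F) = ⟨x, hsub hx⟩ := Subtype.ext (hPid x (hsub hx))
    change ((r ⟨P x, hP x⟩ : closedSpan F) : X) = x
    rw [this, hrid _ hx]
  · exact (hrc ⟨P x, hP x⟩ ⟨P y, hP y⟩).trans (hPc x y)
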